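/- Let $R$ be an associative ring with identity that is von Neumann regular (for every $a\in R$ there is $x\in R$ with $axa=a$). A right $R$-module $M$ is called a $V$-module if every proper submodule of $M$ is an intersection of maximal submodules of $M$, and $R$ is called a right $V$-ring if $R_R$ is a $V$-module. A right $R$-module $M$ is called almost injective if for every right $R$-module $N$, every submodule $N'$ of $N$ with inclusion $\iota:N'\to N$, and every homomorphism $f:N'\to M$, either there is a homomorphism $g:N\to M$ with $g\iota=f$, or there are a nonzero idempotent $\pi\in\operatorname{End}_R(N)$ and a homomorphism $h:M\to\pi(N)$ with $hf=\pi\iota$. The ring $R$ is called a right almost $V$-ring if every simple right $R$-module is almost injective. Then the following assertions are equivalent: 1) $R$ is a right $V$-ring. 2) Every right $R$-module is a direct sum of an injective module and a $V$-module. 3) Every right $R$-module is a direct sum of a projective module and a $V$-module. 4) $R$ is a right almost $V$-ring. -/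

import Mathlib

universe u

/-- A ring is (von Neumann) regular if every element `a` has a quasi-inverse `x`: `a x a = a`. -/
def IsVNRegularRing (R : Type u) [Ring R] : Prop :=
  ∀ a : R, ∃ x : R, a * x * a = a

/-- A module is a `V`-module (cosemisimple) if every proper submodule is an intersection of
maximal submodules. -/
def IsVModule (A : Type u) [Ring A] (M : Type u) [AddCommGroup M] [Module A M] : Prop :=
  ∀ N : Submodule A M, N ≠ ⊤ →
    ∃ S : Set (Submodule A M), (∀ L ∈ S, IsCoatom L) ∧ N = sInf S

/-- `M` is almost `N`-injective: every homomorphism `f : N' → M` from a submodule `N'` of `N`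
either extends to `N`, or there are a nonzero idempotent endomorphism `π` of `N` and a homomorphism
`h : M → π(N)` such that `h ∘ f` is the restriction of `π` to `N'`. -/
def IsAlmostInjectiveRel (A : Type u) [Ring A] (M N : Type u) [AddCommGroup M] [Module A M]
    [AddCommGroup N] [Module A N] : Prop :=
  ∀ (N' : Submodule A N) (f : N' →ₗ[A] M),
    (∃ g : N →ₗ[A] M, g ∘ₗ N'.subtype = f) ∨
    ∃ π : Module.End A N, π ≠ 0 ∧ IsIdempotentElem π ∧
      ∃ h : M →ₗ[A] LinearMap.range π,
        (LinearMap.range π).subtype ∘ₗ h ∘ₗ f = π ∘ₗ N'.subtype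

/-- `M` is almost injective if it is almost `N`-injective for every module `N`. -/
def IsAlmostInjective (A : Type u) [Ring A] (M : Type u) [AddCommGroup M] [Module A M] : Prop :=
  ∀ (N : Type u) [AddCommGroup N] [Module A N], IsAlmostInjectiveRel A M N

/-! Right `R`-modules are modules over the opposite ring `Rᵐᵒᵖ`. -/

/-- `R` is a right `V`-ring if the right module `R_R` is a `V`-module. -/
def IsRightVRing (R : Type u) [Ring R] : Prop :=
  IsVModule Rᵐᵒᵖ R

/-- `R` is a right almost `V`-ring if every simple right `R`-module is almost injective. -/
def IsRightAlmostVRing (R : Type u) [Ring R] : Prop :=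
  ∀ (S : Type u) [AddCommGroup S] [Module Rᵐᵒᵖ S],
    IsSimpleModule Rᵐᵒᵖ S → IsAlmostInjective Rᵐᵒᵖ S

/-!
A ring is a `V`-ring if and only if every simple submodule `S` of every module `E` is a direct
summand. To split `S ≤ E` it suffices to find a map from `E` that does not kill `S` into a module
whose simple submodules split, such as a `V`-module or, since cyclic left ideals of a regular ring
are summands, the regular ring itself. If `E = P ⊕ Q` with `P` projective and `Q` a `V`-module, such
a map is the projection to `Q` or a functional on `P`.

When `P` is injective instead, decompose `E^(ℕ) = P ⊕ Q`. Either some copy of `S` survives in `Q`,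
or `S^(ℕ) ≤ P`; in the latter case `S` is itself injective, because over a regular ring a map from a
left ideal to `S` with no extension produces a map from a left ideal to `S^(ℕ)` all of whose
components are nonzero, and no such map extends to a map from the ring to `E^(ℕ)`.

If `S` is simple and almost injective, extend a given map to an essential submodule `D` of the ring.
The idempotent of the second alternative cannot vanish on `D`, so `S` embeds in the ring and splits
there, which again yields an extension.
-/

section LinearMaps

variable {A M N : Type*} [Ring A] [AddCommGroup M] [Module A M] [AddCommGroup N] [Module A N]

theorem isComplemented_of_retraction {S : Submodule A M} (p : M →ₗ[A] S) (hp : ∀ s : S, p s = s) :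
    IsComplemented S :=
  ⟨_, LinearMap.isCompl_of_proj hp⟩

theorem isComplemented_of_disjoint_ker {S : Submodule A M} (g : M →ₗ[A] N)
    (hS : Disjoint S (LinearMap.ker g)) (hgS : IsComplemented (S.map g)) : IsComplemented S := by
  obtain ⟨T, hdisj, hcodisj⟩ := hgS
  refine ⟨T.comap g, Submodule.disjoint_def.mpr fun x hxS hxT => ?_, ?_⟩
  · have hgx : g x = 0 := Submodule.disjoint_def.mp hdisj _ (Submodule.mem_map_of_mem hxS) hxT
    exact Submodule.disjoint_def.mp hS x hxS hgx
  · refine codisjoint_iff_le_sup.mpr fun m _ => ?_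
    obtain ⟨_, ⟨s, hs, rfl⟩, t, ht, hst⟩ :=
      Submodule.mem_sup.mp (hcodisj.eq_top ▸ Submodule.mem_top : g m ∈ S.map g ⊔ T)
    refine Submodule.mem_sup.mpr ⟨s, hs, m - s, ?_, add_sub_cancel s m⟩
    rwa [Submodule.mem_comap, map_sub, ← hst, add_sub_cancel_left]

theorem exists_comp_eq_of_ker_le {P : Type*} [AddCommGroup P] [Module A P] {q : M →ₗ[A] N}
    (hq : Function.Surjective q) {f : M →ₗ[A] P} (h : LinearMap.ker q ≤ LinearMap.ker f) :
    ∃ φ : N →ₗ[A] P, φ ∘ₗ q = f := by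
  refine ⟨(LinearMap.ker q).liftQ f h ∘ₗ (q.quotKerEquivOfSurjective hq).symm.toLinearMap,
    LinearMap.ext fun x => ?_⟩
  have hx : (q.quotKerEquivOfSurjective hq).symm (q x) = (LinearMap.ker q).mkQ x :=
    (LinearEquiv.symm_apply_eq _).mpr rfl
  exact congrArg ((LinearMap.ker q).liftQ f h) hx

theorem exists_extension_to_essential_submodule (N' : Submodule A N) (f : N' →ₗ[A] M) :
    ∃ (D : Submodule A N) (hD : N' ≤ D) (F : D →ₗ[A] M), F ∘ₗ Submodule.inclusion hD = f ∧
      ∀ T, Disjoint D T → T = ⊥ := by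
  have : Fact (Function.Injective N'.subtype) := ⟨N'.injective_subtype⟩
  let F := Module.Baer.extensionOfMax N'.subtype f
  refine ⟨F.domain, N'.range_subtype.ge.trans F.le, F.toFun,
    LinearMap.ext fun x => (F.is_extension x).symm, fun T hT => ?_⟩
  let G := F.toLinearPMap.sup ⟨T, 0⟩ (LinearPMap.sup_h_of_disjoint _ _ hT)
  have hFG : F.toLinearPMap ≤ G := LinearPMap.left_le_sup _ _ _
  let G' : Module.Baer.ExtensionOf N'.subtype f :=
    { G with
      le := F.le.trans hFG.1
      is_extension := fun m => (F.is_extension m).trans (hFG.2 rfl) }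
  have hG' : G' = F := Module.Baer.extensionOfMax_is_max _ _ G' hFG
  have hTF : T ≤ F.domain := (le_sup_right : T ≤ F.domain ⊔ T).trans (congrArg (·.domain) hG').le
  exact hT.eq_bot_of_ge hTF

theorem exists_finsupp_linearMap {ι : Type*} (f : ι → M →ₗ[A] N)
    (hf : ∀ x, (Function.support fun i => f i x).Finite) :
    ∃ F : M →ₗ[A] ι →₀ N, ∀ x i, F x i = f i x :=
  ⟨{ toFun := fun x => Finsupp.ofSupportFinite _ (hf x)
     map_add' := fun x y => Finsupp.ext fun i => map_add (f i) x y
     map_smul' := fun c x => Finsupp.ext fun i => map_smul (f i) c x }, fun _ _ => rfl⟩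

end LinearMaps

section SimpleSubmodules

variable {A M N : Type*} [Ring A] [AddCommGroup M] [Module A M] [AddCommGroup N] [Module A N]

/-- Every simple submodule of `M` is a direct summand of `M`; equivalently, the socle of `M` meets
its radical trivially. -/
def SimpleSubmodulesSplit (A M : Type*) [Ring A] [AddCommGroup M] [Module A M] : Prop :=
  ∀ S : Submodule A M, IsSimpleModule A S → IsComplemented S

theorem SimpleSubmodulesSplit.isComplemented_of_not_le_ker (hN : SimpleSubmodulesSplit A N)
    {S : Submodule A M} [IsSimpleModule A S] (g : M →ₗ[A] N) (hg : ¬ S ≤ LinearMap.ker g) :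
    IsComplemented S := by
  have hdisj : Disjoint S (LinearMap.ker g) := IsSimpleModule.isAtom.not_le_iff_disjoint.mp hg
  have hinj : Function.Injective (g.domRestrict S) := by
    rw [← LinearMap.ker_eq_bot, LinearMap.ker_domRestrict, ← Submodule.disjoint_iff_comap_eq_bot]
    exact hdisj
  refine isComplemented_of_disjoint_ker g hdisj (hN _ ?_)
  rw [← LinearMap.range_domRestrict]
  exact IsSimpleModule.congr (LinearEquiv.ofInjective _ hinj).symm

theorem SimpleSubmodulesSplit.exists_leftInverse (hN : SimpleSubmodulesSplit A N)
    [IsSimpleModule A M] {j : M →ₗ[A] N} (hj : Function.Injective j) :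
    ∃ p : N →ₗ[A] M, p ∘ₗ j = LinearMap.id := by
  let e := LinearEquiv.ofInjective j hj
  have hcompl : IsComplemented (LinearMap.range j) := hN _ (IsSimpleModule.congr e.symm)
  obtain ⟨p, hp⟩ := LinearMap.surjective_comp_subtype_of_isComplemented hcompl e.symm.toLinearMap
  exact ⟨p, LinearMap.ext fun m => (DFunLike.congr_fun hp (e m)).trans (e.symm_apply_apply m)⟩

end SimpleSubmodules

section VModule

variable {A : Type u} [Ring A] {M : Type u} [AddCommGroup M] [Module A M]

theorem isVModule_iff_exists_isCoatom : IsVModule A M ↔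
    ∀ (N : Submodule A M) (y : M), y ∉ N → ∃ K, IsCoatom K ∧ N ≤ K ∧ y ∉ K := by
  constructor
  · intro h N y hy
    obtain ⟨C, hC, rfl⟩ := h N (ne_of_mem_of_not_mem' Submodule.mem_top hy).symm
    simp only [Submodule.mem_sInf, not_forall] at hy
    obtain ⟨K, hK, hyK⟩ := hy
    exact ⟨K, hC K hK, sInf_le hK, hyK⟩
  · intro h N _
    refine ⟨{K | IsCoatom K ∧ N ≤ K}, fun K hK => hK.1,
      le_antisymm (le_sInf fun K hK => hK.2) fun y hy => ?_⟩
    by_contra hyN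
    obtain ⟨K, hK, hNK, hyK⟩ := h N y hyN
    exact hyK (Submodule.mem_sInf.mp hy K ⟨hK, hNK⟩)

theorem IsVModule.of_linearEquiv {M' : Type u} [AddCommGroup M'] [Module A M'] (e : M ≃ₗ[A] M')
    (h : IsVModule A M) : IsVModule A M' := by
  rw [isVModule_iff_exists_isCoatom] at h ⊢
  intro N y hy
  obtain ⟨K, hK, hNK, hyK⟩ := h (N.comap e.toLinearMap) (e.symm y) (by simpa using hy)
  exact ⟨K.comap e.symm.toLinearMap, (Submodule.isCoatom_comap_iff e.symm.surjective).mpr hK,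
    fun z hz => hNK (by simpa using hz), hyK⟩

theorem IsVModule.simpleSubmodulesSplit (h : IsVModule A M) : SimpleSubmodulesSplit A M := by
  intro S hS
  obtain ⟨s, hs, hs0⟩ := S.ne_bot_iff.mp IsSimpleModule.isAtom.ne_bot
  obtain ⟨K, hK, -, hsK⟩ := isVModule_iff_exists_isCoatom.mp h ⊥ s hs0
  have hSK : ¬ S ≤ K := fun hle => hsK (hle hs)
  exact ⟨K, IsSimpleModule.isAtom.not_le_iff_disjoint.mp hSK,
    (hK.not_le_iff_codisjoint.mp hSK).symm⟩

theorem IsVModule.exists_extension (h : IsVModule A M) {S : Type*} [AddCommGroup S] [Module A S]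
    [IsSimpleModule A S] (N : Submodule A M) (f : N →ₗ[A] S) :
    ∃ g : M →ₗ[A] S, g ∘ₗ N.subtype = f := by
  obtain rfl | hf := eq_or_ne f 0
  · exact ⟨0, rfl⟩
  obtain ⟨y, hy⟩ := DFunLike.ne_iff.mp hf
  obtain ⟨K, hK, hfK, hyK⟩ := isVModule_iff_exists_isCoatom.mp h
    ((LinearMap.ker f).map N.subtype) y (by simpa using hy)
  let q : N →ₗ[A] M ⧸ K := K.mkQ ∘ₗ N.subtype
  have hq : q ≠ 0 := DFunLike.ne_iff.mpr ⟨y, by simpa [q] using hyK⟩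
  have : IsSimpleModule A (M ⧸ K) := isSimpleModule_iff_isCoatom.mpr hK
  have hqsurj : Function.Surjective q := LinearMap.surjective_of_ne_zero hq
  have hker : LinearMap.ker q = LinearMap.ker f := by
    refine ((LinearMap.isCoatom_ker_of_surjective
      (LinearMap.surjective_of_ne_zero hf)).le_iff.mp fun x hx => ?_).resolve_left
        (LinearMap.ker_eq_top.not.mpr hq)
    simpa [q] using hfK (Submodule.mem_map_of_mem hx)
  obtain ⟨φ, hφ⟩ := exists_comp_eq_of_ker_le hqsurj hker.le
  exact ⟨φ ∘ₗ K.mkQ, hφ⟩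

theorem isComplemented_of_injective (S : Submodule A M) [hS : Module.Injective A S] :
    IsComplemented S := by
  obtain ⟨p, hp⟩ := hS.out S.subtype S.injective_subtype LinearMap.id
  exact isComplemented_of_retraction p hp

/-- Kill a maximal submodule of the cyclic submodule generated by `y` in `M ⧸ N`: what is left of
that cyclic submodule is simple, and complements of it pull back to maximal submodules of `M`
avoiding `y`. -/
theorem isVModule_of_simpleSubmodulesSplit
    (h : ∀ (E : Type u) [AddCommGroup E] [Module A E], SimpleSubmodulesSplit A E) :
    IsVModule A M := by
  refine isVModule_iff_exists_isCoatom.mpr fun N y hy => ?_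
  let T : Submodule A (M ⧸ N) := A ∙ N.mkQ y
  let t : T := ⟨N.mkQ y, Submodule.mem_span_singleton_self _⟩
  have ht : t ≠ 0 := fun h0 => hy (by simpa [t] using h0)
  have : Nontrivial T := ⟨t, 0, ht⟩
  obtain ⟨K, hK, -⟩ := (eq_top_or_exists_le_coatom (⊥ : Submodule A T)).resolve_left bot_ne_top
  have htK : t ∉ K := fun htK => hK.1 <| eq_top_iff.mpr fun x _ => by
    obtain ⟨c, hc⟩ := Submodule.mem_span_singleton.mp x.2
    exact (Subtype.ext hc : c • t = x) ▸ K.smul_mem c htK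
  let π : M ⧸ N →ₗ[A] (M ⧸ N) ⧸ K.map T.subtype := (K.map T.subtype).mkQ
  let q := π ∘ₗ T.subtype
  have hker : LinearMap.ker q = K := by
    rw [LinearMap.ker_comp, Submodule.ker_mkQ,
      Submodule.comap_map_eq_of_injective T.injective_subtype]
  have hsimple : IsSimpleModule A (LinearMap.range q) := by
    rw [← q.quotKerEquivRange.isSimpleModule_iff, isSimpleModule_iff_isCoatom, hker]
    exact hK
  obtain ⟨C, hC⟩ := h _ (LinearMap.range q) hsimple
  refine ⟨C.comap (π ∘ₗ N.mkQ), (Submodule.isCoatom_comap_iff (f := π ∘ₗ N.mkQ)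
    ((K.map T.subtype).mkQ_surjective.comp N.mkQ_surjective)).mpr
      (hC.isAtom_iff_isCoatom.mp IsSimpleModule.isAtom), fun n hn => ?_, fun hyC => htK ?_⟩
  · simp [(Submodule.Quotient.mk_eq_zero N).mpr hn]
  · rw [← hker]
    exact Submodule.disjoint_def.mp hC.disjoint _ (LinearMap.mem_range_self q t) hyC

/-- The first equivalence is due to Villamayor. -/
theorem isVModule_self_tfae (A : Type u) [Ring A] : List.TFAE [
    IsVModule A A,
    ∀ (S : Type u) [AddCommGroup S] [Module A S], IsSimpleModule A S → Module.Injective A S,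
    ∀ (M : Type u) [AddCommGroup M] [Module A M], SimpleSubmodulesSplit A M,
    ∀ (M : Type u) [AddCommGroup M] [Module A M], IsVModule A M] := by
  tfae_have 1 → 2 := fun h S _ _ _ => Module.Baer.injective fun I f => by
    obtain ⟨g, rfl⟩ := h.exists_extension I f
    exact ⟨g, fun _ _ => rfl⟩
  tfae_have 2 → 3 := fun h M _ _ S hS =>
    have := h S hS
    isComplemented_of_injective S
  tfae_have 3 → 4 := fun h M _ _ => isVModule_of_simpleSubmodulesSplit h
  tfae_have 4 → 1 := fun h => h A
  tfae_finish

end VModule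

section AlmostInjective

variable {A S N : Type u} [Ring A] [AddCommGroup S] [Module A S] [AddCommGroup N] [Module A N]

theorem IsAlmostInjectiveRel.exists_extension [IsSimpleModule A S]
    (h : IsAlmostInjectiveRel A S N) (hN : SimpleSubmodulesSplit A N) (N' : Submodule A N)
    (f : N' →ₗ[A] S) : ∃ g : N →ₗ[A] S, g ∘ₗ N'.subtype = f := by
  obtain ⟨D, hD, F, rfl, hess⟩ := exists_extension_to_essential_submodule N' f
  suffices ∃ g : N →ₗ[A] S, g ∘ₗ D.subtype = F by
    obtain ⟨g, rfl⟩ := this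
    exact ⟨g, rfl⟩
  obtain hg | ⟨π, hπ0, hπ, k, hk⟩ := h D F
  · exact hg
  obtain hkinj | rfl := k.injective_or_eq_zero
  · obtain ⟨p, hp⟩ := hN.exists_leftInverse
      (j := (LinearMap.range π).subtype ∘ₗ k) (Subtype.val_injective.comp hkinj)
    refine ⟨p ∘ₗ π, ?_⟩
    rw [LinearMap.comp_assoc, ← hk]
    exact congrArg (· ∘ₗ F) hp
  · -- `π` vanishes on the essential submodule `D`, which therefore misses its range.
    have hdisj : Disjoint D (LinearMap.range π) := Submodule.disjoint_def.mpr fun x hxD hx => by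
      obtain ⟨z, rfl⟩ := hx
      have hππ : π (π z) = π z := DFunLike.congr_fun hπ.eq z
      rw [← hππ]
      exact (DFunLike.congr_fun hk ⟨π z, hxD⟩).symm
    exact absurd (LinearMap.range_eq_bot.mp (hess _ hdisj)) hπ0

end AlmostInjective

section RegularRing

variable {A : Type u} [Ring A]

theorem IsVNRegularRing.mulOpposite (hA : IsVNRegularRing A) : IsVNRegularRing Aᵐᵒᵖ := by
  intro a
  obtain ⟨x, hx⟩ := hA a.unop
  exact ⟨MulOpposite.op x, MulOpposite.unop_injective (by simpa [mul_assoc] using hx)⟩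

theorem IsVNRegularRing.isComplemented_span_singleton (hA : IsVNRegularRing A) (a : A) :
    IsComplemented (A ∙ a) := by
  obtain ⟨x, hx⟩ := hA a
  refine isComplemented_of_retraction (LinearMap.toSpanSingleton A (A ∙ a)
    ⟨x * a, Submodule.mem_span_singleton.mpr ⟨x, rfl⟩⟩) fun ⟨s, hs⟩ => Subtype.ext ?_
  obtain ⟨c, rfl⟩ := Submodule.mem_span_singleton.mp hs
  simp [mul_assoc, ← mul_assoc a, hx]

theorem IsVNRegularRing.simpleSubmodulesSplit (hA : IsVNRegularRing A) :
    SimpleSubmodulesSplit A A := by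
  intro S hS
  obtain ⟨s, hs, hs0⟩ := S.ne_bot_iff.mp IsSimpleModule.isAtom.ne_bot
  have hspan : A ∙ s = S := (IsSimpleModule.isAtom.le_iff.mp
    ((Submodule.span_singleton_le_iff_mem s S).mpr hs)).resolve_left (by simpa using hs0)
  exact hspan ▸ hA.isComplemented_span_singleton s

/-- Any left ideal `A g + A r` containing the idempotent `g` is of the form `A g'` with `g'`
idempotent: write `r - r g = q` as `q e` with `e` an idempotent of `A q`, so that `e g = 0`. -/
theorem IsVNRegularRing.exists_idempotent_mem (hA : IsVNRegularRing A) {J : Ideal A} {g r : A}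
    (hg : IsIdempotentElem g) (hgJ : g ∈ J) (hrJ : r ∈ J) :
    ∃ g' ∈ J, IsIdempotentElem g' ∧ g * g' = g ∧ r * g' = r := by
  let q := r - r * g
  obtain ⟨x, hx⟩ := hA q
  let e := x * q
  have hqJ : q ∈ J := J.sub_mem hrJ (J.mul_mem_left r hgJ)
  have heJ : e ∈ J := J.mul_mem_left x hqJ
  have hqe : q * e = q := by rw [← mul_assoc, hx]
  have hee : e * e = e := by rw [mul_assoc, hqe]
  have hqg : q * g = 0 := by rw [sub_mul, mul_assoc, hg.eq, sub_self]
  have heg : e * g = 0 := by rw [mul_assoc, hqg, mul_zero]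
  have hgg' : g * (g + e - g * e) = g := by
    rw [mul_sub, mul_add, ← mul_assoc g g, hg.eq, add_sub_cancel_right]
  have heg' : e * (g + e - g * e) = e := by
    rw [mul_sub, mul_add, ← mul_assoc e g, heg, hee, zero_mul, zero_add, sub_zero]
  refine ⟨g + e - g * e, J.sub_mem (J.add_mem hgJ heJ) (J.mul_mem_left g heJ), ?_, hgg', ?_⟩
  · rw [IsIdempotentElem, sub_mul, add_mul, mul_assoc g, hgg', heg']
  · have hr : r = q * e + r * g := by rw [hqe, sub_add_cancel]
    calc r * (g + e - g * e)
        = q * (e * (g + e - g * e)) + r * (g * (g + e - g * e)) := by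
          conv_lhs => rw [hr]
          simp only [add_mul, mul_assoc]
      _ = r := by rw [heg', hgg', ← hr]

theorem IsVNRegularRing.exists_idempotent_chain (hA : IsVNRegularRing A) {S : Type*}
    [AddCommGroup S] [Module A S] {J : Ideal A} {ρ : J →ₗ[A] S}
    (hρ : ∀ g : J, ∃ r : J, ρ r ≠ (r : A) • ρ g) :
    ∃ g : ℕ → J, (∀ m n, m ≤ n → (g m : A) * g n = g m) ∧
      ∀ n, ρ (g (n + 1)) ≠ (g (n + 1) : A) • ρ (g n) := by
  have hstep (g : {g : J // IsIdempotentElem (g : A)}) :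
      ∃ g' : {g : J // IsIdempotentElem (g : A)}, (g.1 : A) * g'.1 = g.1 ∧
        ρ g'.1 ≠ (g'.1 : A) • ρ g.1 := by
    obtain ⟨r, hr⟩ := hρ g.1
    obtain ⟨g', hg'J, hg', hgg', hrg'⟩ := hA.exists_idempotent_mem g.2 g.1.2 r.2
    refine ⟨⟨⟨g', hg'J⟩, hg'⟩, hgg', fun hρg' => hr ?_⟩
    calc ρ r = ρ ((r : A) • ⟨g', hg'J⟩) := congrArg ρ (Subtype.ext hrg'.symm)
      _ = (r : A) • ρ g.1 := by rw [map_smul, hρg', ← mul_smul, hrg']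
  choose next hmul hne using hstep
  let g : ℕ → {g : J // IsIdempotentElem (g : A)} :=
    Nat.rec ⟨0, IsIdempotentElem.zero⟩ fun _ => next
  refine ⟨fun n => (g n).1, fun m n hmn => ?_, fun n => hne (g n)⟩
  induction n, hmn using Nat.le_induction with
  | base => exact (g m).2
  | succ n _ ih =>
    calc ((g m).1 : A) * (g (n + 1)).1 = (g m).1 * ((g n).1 * (next (g n)).1) := by
          rw [← mul_assoc, ih]
      _ = (g m).1 := by rw [hmul, ih]

/-- A map `ρ : J → S` without extension to `A` yields a chain of idempotents `g n` of `J` along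
which the errors `r ↦ ρ r - r • ρ (g n)` are nonzero on `⋃ n, A (g n)`, although the `n`-th one
vanishes on `A (g m)` for all `m ≤ n`. -/
theorem IsVNRegularRing.injective_of_exists_eq_zero (hA : IsVNRegularRing A) {S : Type u}
    [AddCommGroup S] [Module A S]
    (hS : ∀ (I : Ideal A) (f : ℕ → I →ₗ[A] S),
      (∀ r, (Function.support fun n => f n r).Finite) → ∃ n, f n = 0) :
    Module.Injective A S := by
  refine Module.Baer.injective fun J ρ => ?_
  by_contra! hρ
  obtain ⟨g, hg, hgne⟩ := hA.exists_idempotent_chain (ρ := ρ) fun g => by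
    obtain ⟨r, hrJ, hr⟩ := hρ (LinearMap.toSpanSingleton A S (ρ g))
    exact ⟨⟨r, hrJ⟩, hr.symm⟩
  let I : Ideal A := ⨆ n, A ∙ (g n : A)
  have hmem {r : A} (hr : r ∈ I) : ∃ m, ∀ n, m ≤ n → r * g n = r := by
    have hmono : Monotone fun n => A ∙ (g n : A) := fun m n hmn =>
      (Submodule.span_singleton_le_iff_mem _ _).mpr
        (Submodule.mem_span_singleton.mpr ⟨g m, hg m n hmn⟩)
    obtain ⟨m, hm⟩ := (Submodule.mem_iSup_of_directed _ hmono.directed_le).mp hr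
    obtain ⟨c, rfl⟩ := Submodule.mem_span_singleton.mp hm
    exact ⟨m, fun n hmn => by rw [smul_eq_mul, mul_assoc, hg m n hmn]⟩
  have hIJ : I ≤ J := iSup_le fun n => (Submodule.span_singleton_le_iff_mem _ _).mpr (g n).2
  let f (n : ℕ) : I →ₗ[A] S :=
    (ρ - (LinearMap.toSpanSingleton A S (ρ (g n))).domRestrict J) ∘ₗ Submodule.inclusion hIJ
  have hf (n : ℕ) (r : I) : f n r = ρ (Submodule.inclusion hIJ r) - (r : A) • ρ (g n) := rfl
  obtain ⟨n, hn⟩ := hS I f fun r => by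
    obtain ⟨m, hm⟩ := hmem r.2
    refine (Set.finite_lt_nat m).subset fun n hn => ?_
    by_contra hmn
    have hr : Submodule.inclusion hIJ r = (r : A) • g n := Subtype.ext (hm n (not_lt.mp hmn)).symm
    exact hn (show f n r = 0 by rw [hf, hr, map_smul, sub_self])
  have hgI : (g (n + 1) : A) ∈ I :=
    Submodule.mem_iSup_of_mem (n + 1) (Submodule.mem_span_singleton_self _)
  exact hgne n (sub_eq_zero.mp (DFunLike.congr_fun hn ⟨_, hgI⟩))

theorem IsVNRegularRing.injective_of_single_mem (hA : IsVNRegularRing A) {E : Type u}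
    [AddCommGroup E] [Module A E] {S : Submodule A E} {P : Submodule A (ℕ →₀ E)}
    [hP : Module.Injective A P] (hS : ∀ n, ∀ s ∈ S, Finsupp.single n s ∈ P) :
    Module.Injective A S := by
  refine hA.injective_of_exists_eq_zero fun I f hf => ?_
  obtain ⟨F, hF⟩ := exists_finsupp_linearMap (fun n => S.subtype ∘ₗ f n) fun r =>
    (hf r).subset fun n hn h0 => hn (by simpa using h0)
  have hFP (r : I) : F r ∈ P := by
    rw [← Finsupp.sum_single (F r)]
    exact Submodule.sum_mem _ fun n _ => hS n _ (hF r n ▸ (f n r).2)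
  obtain ⟨G, hG⟩ := hP.out I.subtype I.injective_subtype (F.codRestrict P hFP)
  obtain ⟨n, hn⟩ := Infinite.exists_notMem_finset (G 1 : ℕ →₀ E).support
  refine ⟨n, LinearMap.ext fun r => Subtype.ext ?_⟩
  have hGr : G r = (r : A) • G 1 := by rw [← map_smul, smul_eq_mul, mul_one]
  calc (f n r : E) = F r n := (hF r n).symm
    _ = (G r : ℕ →₀ E) n := by rw [show G r = _ from hG r]; rfl
    _ = (r : A) • (G 1 : ℕ →₀ E) n := by rw [hGr]; rfl
    _ = 0 := by rw [Finsupp.notMem_support_iff.mp hn, smul_zero]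

end RegularRing

section Decompositions

variable {A E : Type u} [Ring A] [AddCommGroup E] [Module A E]

theorem IsVNRegularRing.isComplemented_of_injective_decomposition (hA : IsVNRegularRing A)
    (S : Submodule A E) [IsSimpleModule A S] {P Q : Submodule A (ℕ →₀ E)} (hPQ : IsCompl P Q)
    [Module.Injective A P] (hQ : IsVModule A Q) : IsComplemented S := by
  let p (n : ℕ) : E →ₗ[A] Q := Q.projectionOnto P hPQ.symm ∘ₗ Finsupp.lsingle n
  by_cases hp : ∀ n, S ≤ LinearMap.ker (p n)
  · have : Module.Injective A S := hA.injective_of_single_mem (P := P) fun n s hs =>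
      (Submodule.projectionOnto_apply_eq_zero_iff hPQ.symm).mp (hp n hs)
    exact isComplemented_of_injective S
  · obtain ⟨n, hn⟩ := not_forall.mp hp
    exact hQ.simpleSubmodulesSplit.isComplemented_of_not_le_ker (p n) hn

theorem SimpleSubmodulesSplit.of_projective_decomposition (hA : SimpleSubmodulesSplit A A)
    {P Q : Submodule A E} (hPQ : IsCompl P Q) [Module.Projective A P] (hQ : IsVModule A Q) :
    SimpleSubmodulesSplit A E := by
  intro S _
  by_cases hSP : S ≤ P
  · obtain ⟨s, hs, hs0⟩ := S.ne_bot_iff.mp IsSimpleModule.isAtom.ne_bot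
    obtain ⟨φ, hφ⟩ := Module.Projective.exists_dual_ne_zero A
      (x := (⟨s, hSP hs⟩ : P)) (by simpa using hs0)
    refine hA.isComplemented_of_not_le_ker (φ ∘ₗ P.projectionOnto Q hPQ) fun hle => hφ ?_
    simpa [Submodule.projectionOnto_apply_of_mem_left hPQ (hSP hs)] using hle hs
  · refine hQ.simpleSubmodulesSplit.isComplemented_of_not_le_ker (Q.projectionOnto P hPQ.symm) ?_
    rwa [Submodule.ker_projectionOnto]

end Decompositions

theorem isRightVRing_iff (R : Type u) [Ring R] : IsRightVRing R ↔ IsVModule Rᵐᵒᵖ Rᵐᵒᵖ :=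
  have e : R ≃ₗ[Rᵐᵒᵖ] Rᵐᵒᵖ := MulOpposite.opLinearEquiv Rᵐᵒᵖ
  ⟨IsVModule.of_linearEquiv e, IsVModule.of_linearEquiv e.symm⟩

theorem theorem2p3 (R : Type u) [Ring R] (hR : IsVNRegularRing R) :
    List.TFAE [
      IsRightVRing R,
      ∀ (M : Type u) [AddCommGroup M] [Module Rᵐᵒᵖ M],
        ∃ P Q : Submodule Rᵐᵒᵖ M,
          IsCompl P Q ∧ Module.Injective Rᵐᵒᵖ P ∧ IsVModule Rᵐᵒᵖ Q,
      ∀ (M : Type u) [AddCommGroup M] [Module Rᵐᵒᵖ M],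
        ∃ P Q : Submodule Rᵐᵒᵖ M,
          IsCompl P Q ∧ Module.Projective Rᵐᵒᵖ P ∧ IsVModule Rᵐᵒᵖ Q,
      IsRightAlmostVRing R] := by
  have hA := hR.mulOpposite
  have hV := isVModule_self_tfae Rᵐᵒᵖ
  have hinj := hV.out 0 1
  have hsplit := hV.out 0 2
  have hall := hV.out 0 3
  rw [isRightVRing_iff]
  tfae_have 1 → 2 := fun h M _ _ => ⟨⊥, ⊤, isCompl_bot_top,
    ⟨fun _ _ _ _ _ _ _ _ _ => ⟨0, fun _ => Subsingleton.elim _ _⟩⟩, hall.mp h _⟩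
  tfae_have 1 → 3 := fun h M _ _ => ⟨⊥, ⊤, isCompl_bot_top, inferInstance, hall.mp h _⟩
  tfae_have 1 → 4 := fun h S _ _ hS N _ _ N' f =>
    have ⟨g, hg⟩ := (hinj.mp h S hS).out N'.subtype N'.injective_subtype f
    Or.inl ⟨g, LinearMap.ext hg⟩
  tfae_have 2 → 1 := fun h => hsplit.mpr fun E _ _ S _ =>
    have ⟨_, _, hPQ, _, hQ⟩ := h (ℕ →₀ E)
    hA.isComplemented_of_injective_decomposition S hPQ hQ
  tfae_have 3 → 1 := fun h => hsplit.mpr fun E _ _ =>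
    have ⟨_, _, hPQ, _, hQ⟩ := h E
    hA.simpleSubmodulesSplit.of_projective_decomposition hPQ hQ
  tfae_have 4 → 1 := fun h => hinj.mpr fun S _ _ hS => Module.Baer.injective fun I f =>
    have ⟨g, hg⟩ := (h S hS Rᵐᵒᵖ).exists_extension hA.simpleSubmodulesSplit I f
    ⟨g, fun r hr => DFunLike.congr_fun hg ⟨r, hr⟩⟩
  tfae_finish
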